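/- **Conventions.** A virtual link diagram is a planar 4-valent link diagram whose crossings are either classical (with over/under information) or virtual. Smoothing a classical crossing replaces it by two disjoint arcs: the type $\alpha$ smoothing joins the two regions swept out when the overcrossing strand is turned counterclockwise, the type $\beta$ smoothing joins the two other regions. A state $s$ of a diagram $K$ is a choice of a smoothing type for each classical crossing; $c(s)$ is the number of $\alpha$'s minus the number of $\beta$'s, and $|s|$ is the number of closed curves (which may cross each other virtually) of the smoothed diagram. With $d=-A^{-2}-A^{2}$, the bracket polynomial is $$\langle K\rangle=\sum_{s}A^{c(s)}d^{\,|s|-1}\in\mathbb Z[A,A^{-1}],$$ so $\langle\text{unknot}\rangle=1$ for the crossingless diagram of the unknot. **Family A.** Read a plane diagram from bottom to top, numbering the strands at each height $0,1,2,\dots$ from left to right. Write $\cup_i$ for a minimum creating the strands $i,i+1$; $\cap_i$ for a maximum joining the strands $i,i+1$; $v_i$ for a virtual crossing of the strands $i,i+1$; $\sigma_i$ for a classical crossing of these strands in which the strand from bottom left to top right passes over; and $\sigma_i^{-1}$ for the one in which it passes under. For $t\in\mathbb Z$ let $\sigma_0^{t}$ denote $|t|$ consecutive crossings $\sigma_0^{\pm1}$,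 of the sign of $t$. The virtual knot diagram $K_D(t)$ of Family A is $$\cup_0\;\cup_2\;v_1\;\sigma_0^{\,t}\;\sigma_1^{-1}\,\sigma_0\,\sigma_2^{-1}\,\sigma_2^{-1}\;\cap_1\;\cup_1\;\sigma_2\,\sigma_2\,\sigma_0^{-1}\,\sigma_1\;\sigma_0^{-t}\;v_1\;\cap_2\;\cap_0 ,$$ that is, the diagram $K_D=K_D(0)$, with $8$ classical and $2$ virtual crossings, with $t$ twists inserted in one half and $-t$ twists in the other, mirror-symmetric half. **Theorem.** For every $t\in\mathbb Z$, $$\langle K_D(t)\rangle=1=\langle\text{unknot}\rangle ;$$ no member of Family A is detected by the bracket polynomial. -/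

import Mathlib

/-!
Virtual link diagrams in the plane, put in general position with respect to the height function and
read from bottom to top.  Between two consecutive critical heights a diagram meets a horizontal
line in finitely many points, numbered `0, 1, 2, …` from left to right; every elementary piece
involves the two neighbouring strands `i` and `i + 1`, and all the other strands run upwards.
-/

namespace VirtualKnot

/-- Pieces without classical crossing: a minimum inserting two new strands `i`, `i + 1`; a maximum
joining the strands `i`, `i + 1`; a virtual crossing of the strands `i`, `i + 1`. -/
inductive Piece where
  | cup (i : ℕ)
  | cap (i : ℕ)
  | virt (i : ℕ)

/-- Elementary pieces of a virtual link diagram.  In the classical crossing `over i` the strand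
that runs from the bottom left (position `i`) to the top right (position `i + 1`) is the
overcrossing strand, in `under i` it is the undercrossing strand. -/
inductive Slice where
  | plain (p : Piece)
  | over (i : ℕ)
  | under (i : ℕ)

/-- The number of strands above a piece when there are `n` strands below it. -/
def Piece.width : Piece → ℕ → ℕ
  | .cup _, n => n + 2
  | .cap _, n => n - 2
  | .virt _, n => n

/-- The two strands a piece involves exist when there are `n` strands below it. -/
def Piece.Fits : Piece → ℕ → Prop
  | .cup i, n => i ≤ n
  | .cap i, n => i + 2 ≤ n
  | .virt i, n => i + 2 ≤ n

/-- Starting with `n` strands, all pieces fit and no strand is left at the top. -/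
def ClosesFrom : ℕ → List Slice → Prop
  | n, [] => n = 0
  | n, .plain p :: w => p.Fits n ∧ ClosesFrom (p.width n) w
  | n, .over i :: w => i + 2 ≤ n ∧ ClosesFrom n w
  | n, .under i :: w => i + 2 ≤ n ∧ ClosesFrom n w

/-- A nonempty virtual link diagram in the plane. -/
structure Diagram where
  word : List Slice
  nonempty : word ≠ []
  closed : ClosesFrom 0 word

/-- The number of strands at level `k`, that is, above the first `k` pieces of `w`. -/
def widthAt (w : List Piece) (k : ℕ) : ℕ :=
  (w.take k).foldl (fun n p => p.width n) 0

/-- The points `(k, j)` of a diagram without classical crossings: strand `j` at level `k`. -/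
def Point (w : List Piece) : Type :=
  {x : ℕ × ℕ // x.1 ≤ w.length ∧ x.2 < widthAt w x.1}

/-- Two points are the ends of one segment of the piece number `k`, which lies between the levels
`k` and `k + 1`. -/
inductive Segment (w : List Piece) : ℕ × ℕ → ℕ × ℕ → Prop
  | cupLeft {k i j : ℕ} (h : w[k]? = some (.cup i)) (hj : j < i) : Segment w (k, j) (k + 1, j)
  | cupRight {k i j : ℕ} (h : w[k]? = some (.cup i)) (hj : i ≤ j) :
      Segment w (k, j) (k + 1, j + 2)
  | cupArc {k i : ℕ} (h : w[k]? = some (.cup i)) : Segment w (k + 1, i) (k + 1, i + 1)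
  | capLeft {k i j : ℕ} (h : w[k]? = some (.cap i)) (hj : j < i) : Segment w (k, j) (k + 1, j)
  | capRight {k i j : ℕ} (h : w[k]? = some (.cap i)) (hj : i ≤ j) :
      Segment w (k, j + 2) (k + 1, j)
  | capArc {k i : ℕ} (h : w[k]? = some (.cap i)) : Segment w (k, i) (k, i + 1)
  | virtSide {k i j : ℕ} (h : w[k]? = some (.virt i)) (h₀ : j ≠ i) (h₁ : j ≠ i + 1) :
      Segment w (k, j) (k + 1, j)
  | virtRight {k i : ℕ} (h : w[k]? = some (.virt i)) : Segment w (k, i) (k + 1, i + 1)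
  | virtLeft {k i : ℕ} (h : w[k]? = some (.virt i)) : Segment w (k, i + 1) (k + 1, i)

/-- The number of closed curves of a diagram without classical crossings: the number of classes
of points under the equivalence relation generated by the segments. -/
noncomputable def curves (w : List Piece) : ℕ :=
  Nat.card (Quot fun x y : Point w => Segment w x.1 y.1)

/-- The two types of smoothing of a classical crossing. -/
inductive Smoothing where
  | alpha
  | beta
  deriving DecidableEq

instance : Fintype Smoothing where
  elems := {.alpha, .beta}
  complete := by intro s; cases s <;> simp

/-- The number of classical crossings. -/
def crossings : List Slice → ℕ
  | [] => 0
  | .plain _ :: w => crossings w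
  | .over _ :: w => crossings w + 1
  | .under _ :: w => crossings w + 1

/-- The smoothing of `over i`.  Type `alpha` joins the two regions swept out when the overcrossing
strand is turned counterclockwise, here the lower and the upper one, so that two parallel upward
strands remain; type `beta` leaves a maximum below a minimum. -/
def smoothOver (i : ℕ) : Smoothing → List Piece
  | .alpha => []
  | .beta => [.cap i, .cup i]

/-- The smoothing of `under i`. -/
def smoothUnder (i : ℕ) : Smoothing → List Piece
  | .alpha => [.cap i, .cup i]
  | .beta => []

/-- The diagram without classical crossings obtained by smoothing the classical crossings of `w`,
numbered from bottom to top, as `s` prescribes. -/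
def smooth : (w : List Slice) → (Fin (crossings w) → Smoothing) → List Piece
  | [], _ => []
  | .plain p :: w, s => p :: smooth w s
  | .over i :: w, s => smoothOver i (s (0 : Fin (crossings w + 1))) ++ smooth w fun k => s k.succ
  | .under i :: w, s => smoothUnder i (s (0 : Fin (crossings w + 1))) ++ smooth w fun k => s k.succ

/-- A state assigns a smoothing type to each classical crossing. -/
abbrev Diagram.State (D : Diagram) : Type := Fin (crossings D.word) → Smoothing

/-- `c(s)`: the number of `alpha` smoothings minus the number of `beta` smoothings. -/
def Diagram.State.c {D : Diagram} (s : D.State) : ℤ :=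
  ((Finset.univ.filter fun k => s k = .alpha).card : ℤ) -
    ((Finset.univ.filter fun k => s k = .beta).card : ℤ)

/-- `d = -A⁻² - A²` in `ℤ[A, A⁻¹]`, where `A ^ k` is `LaurentPolynomial.T k`. -/
noncomputable def d : LaurentPolynomial ℤ :=
  -LaurentPolynomial.T (-2) - LaurentPolynomial.T 2

/-- The bracket polynomial `⟨D⟩ = ∑ₛ A ^ c(s) d ^ (|s| - 1)`. -/
noncomputable def Diagram.bracket (D : Diagram) : LaurentPolynomial ℤ :=
  ∑ s : D.State, LaurentPolynomial.T s.c * d ^ (curves (smooth D.word s) - 1)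

/-- The crossingless diagram of the unknot. -/
def unknot : Diagram where
  word := [.plain (.cup 0), .plain (.cap 0)]
  nonempty := by simp
  closed := by simp [ClosesFrom, Piece.Fits, Piece.width]

/-- `t` half twists (of opposite handedness if `t < 0`) of the strands `0` and `1`. -/
def twist (t : ℤ) : List Slice :=
  List.replicate t.natAbs (if 0 ≤ t then .over 0 else .under 0)

/-- The word of `K_D(t)`.  The second half is the mirror image of the first one in a horizontal
line; in particular it contains `-t` twists. -/
def kdWord (t : ℤ) : List Slice :=
  [.plain (.cup 0), .plain (.cup 2), .plain (.virt 1)] ++ twist t ++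
    [.under 1, .over 0, .under 2, .under 2, .plain (.cap 1),
      .plain (.cup 1), .over 2, .over 2, .under 0, .over 1] ++
    twist (-t) ++ [.plain (.virt 1), .plain (.cap 2), .plain (.cap 0)]

theorem closesFrom_twist (t : ℤ) (n : ℕ) (w : List Slice) (hn : 2 ≤ n) (h : ClosesFrom n w) :
    ClosesFrom n (twist t ++ w) := by
  unfold twist
  generalize t.natAbs = m
  induction m with
  | zero => simpa using h
  | succ m ih =>
    split_ifs with ht
    · simp only [ht, if_true] at ih
      exact ⟨by omega, ih⟩
    · simp only [ht, if_false] at ih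
      exact ⟨by omega, ih⟩

theorem closesFrom_kdWord (t : ℤ) : ClosesFrom 0 (kdWord t) := by
  have h₁ := closesFrom_twist (-t) 4
    [.plain (.virt 1), .plain (.cap 2), .plain (.cap 0)] (by norm_num)
    (by simp [ClosesFrom, Piece.Fits, Piece.width])
  have h₂ := closesFrom_twist t 4
    ([.under 1, .over 0, .under 2, .under 2, .plain (.cap 1),
      .plain (.cup 1), .over 2, .over 2, .under 0, .over 1] ++
      (twist (-t) ++ [.plain (.virt 1), .plain (.cap 2), .plain (.cap 0)])) (by norm_num)
    (by simpa [ClosesFrom, Piece.Fits, Piece.width] using h₁)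
  simpa [kdWord, ClosesFrom, Piece.Fits, Piece.width] using h₂

/-- The diagram `K_D(t)`, `t ∈ ℤ`. -/
def KD (t : ℤ) : Diagram where
  word := kdWord t
  nonempty := by simp [kdWord]
  closed := closesFrom_kdWord t

end VirtualKnot

/-!
The closed curves of a smoothed diagram are counted by colouring them from bottom to top, so the
state sum of the upper part of a diagram depends on the lower part only through the way in which
the strands in between are joined below.  When four strands are joined below in pairs, a maximum
followed by a minimum has the same effect at the strands `0, 1` as at the strands `2, 3`: the
pairing below contains the arc `0, 1` if and only if it contains the arc `2, 3`.  Hence `σ₀` acts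
as `σ₂`, and `σ₀ σ₂⁻¹` cancels in both halves of `K_D(t)`.  Sliding the remaining strand over the
maximum, respectively the minimum, turns the lower half into `∩₂` and the upper half into `∪₂`.
Then every twist is a kink, and the kinks of the two halves contribute `(-A⁻³) ^ t` and
`(-A⁻³) ^ (-t)`.
-/

namespace VirtualKnot

open LaurentPolynomial

/-! ### Colourings by closed curves -/

section Colorings

variable {α β : Type*}

/-- The position of strand `j` after two new strands have been inserted at `i` and `i + 1`. -/
def skip (i j : ℕ) : ℕ := if j < i then j else j + 2

theorem skip_of_lt {i j : ℕ} (h : j < i) : skip i j = j := if_pos h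

theorem skip_of_le {i j : ℕ} (h : i ≤ j) : skip i j = j + 2 := if_neg h.not_gt

/-- The colours `a` of the `n` strands below a piece and the colours `b` of the strands above it
are constant along the arcs of the piece. -/
def Piece.Compatible (n : ℕ) : Piece → (ℕ → α) → (ℕ → α) → Prop
  | .cup i, a, b => (∀ j < n, b (skip i j) = a j) ∧ b i = b (i + 1)
  | .cap i, a, b => (∀ j < n - 2, b j = a (skip i j)) ∧ a i = a (i + 1)
  | .virt i, a, b => ∀ j < n, b j = a (Equiv.swap i (i + 1) j)

/-- A colouring `f k j` of the strands `j` at the levels `k` of a diagram without classical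
crossings that is constant along every closed curve. -/
def IsColoring (w : List Piece) (f : ℕ → ℕ → α) : Prop :=
  ∀ (k : ℕ) (p : Piece), w[k]? = some p → p.Compatible (widthAt w k) (f k) (f (k + 1))

/-- All pieces of a word, read from bottom to top, involve existing strands only. -/
def WellFormed (w : List Piece) : Prop :=
  ∀ (k : ℕ) (p : Piece), w[k]? = some p → p.Fits (widthAt w k)

/-- Strand `j` exists at level `k`. -/
def Valid (w : List Piece) (k j : ℕ) : Prop :=
  k ≤ w.length ∧ j < widthAt w k

theorem widthAt_succ {w : List Piece} {k : ℕ} {p : Piece} (h : w[k]? = some p) :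
    widthAt w (k + 1) = p.width (widthAt w k) := by
  simp [widthAt, List.take_add_one, h]

theorem widthAt_append {u v : List Piece} {k : ℕ} (hk : k ≤ u.length) :
    widthAt (u ++ v) k = widthAt u k := by
  rw [widthAt, List.take_append_of_le_length hk, widthAt]

theorem widthAt_concat (u : List Piece) (p : Piece) :
    widthAt (u ++ [p]) (u.length + 1) = p.width (widthAt u u.length) := by
  rw [widthAt_succ List.getElem?_concat_length, widthAt_append le_rfl]

theorem forall_getElem?_concat {γ : Type*} {u : List γ} {a : γ} {P : ℕ → γ → Prop} :
    (∀ k b, (u ++ [a])[k]? = some b → P k b) ↔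
      (∀ k b, u[k]? = some b → P k b) ∧ P u.length a := by
  refine ⟨fun h => ⟨fun k b hk => h k b ?_, h _ _ List.getElem?_concat_length⟩, ?_⟩
  · rwa [List.getElem?_append_left (List.getElem?_eq_some_iff.1 hk).1]
  · rintro ⟨h, ha⟩ k b hk
    rw [List.getElem?_append] at hk
    split_ifs at hk with hlt
    · exact h k b hk
    · obtain ⟨hk₀, rfl⟩ := by simpa using List.getElem?_eq_some_iff.1 hk
      rwa [show k = u.length by omega]

theorem wellFormed_concat {u : List Piece} {p : Piece} :
    WellFormed (u ++ [p]) ↔ WellFormed u ∧ p.Fits (widthAt u u.length) := by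
  rw [WellFormed, forall_getElem?_concat, widthAt_append le_rfl]
  refine and_congr_left' (forall₃_congr fun k q hk => ?_)
  rw [widthAt_append (List.getElem?_eq_some_iff.1 hk).1.le]

theorem isColoring_concat {u : List Piece} {p : Piece} {f : ℕ → ℕ → α} :
    IsColoring (u ++ [p]) f ↔ IsColoring u f ∧
      p.Compatible (widthAt u u.length) (f u.length) (f (u.length + 1)) := by
  rw [IsColoring, forall_getElem?_concat, widthAt_append le_rfl]
  refine and_congr_left' (forall₃_congr fun k q hk => ?_)
  rw [widthAt_append (List.getElem?_eq_some_iff.1 hk).1.le]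

theorem valid_concat {u : List Piece} {p : Piece} {k j : ℕ} :
    Valid (u ++ [p]) k j ↔
      Valid u k j ∨ k = u.length + 1 ∧ j < p.width (widthAt u u.length) := by
  rw [Valid, List.length_append, List.length_singleton, Nat.le_add_one_iff, or_and_right]
  refine or_congr (and_congr_right fun hk => ?_) (and_congr_right fun hk => ?_)
  · rw [widthAt_append hk]
  · rw [hk, widthAt_concat]

theorem IsColoring.map {w : List Piece} {f : ℕ → ℕ → α} (hf : IsColoring w f) (φ : α → β) :
    IsColoring w fun k j => φ (f k j) := by
  intro k p hp
  have h := hf k p hp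
  cases p with
  | cup i | cap i => exact ⟨fun j hj => congrArg φ (h.1 j hj), congrArg φ h.2⟩
  | virt i => exact fun j hj => congrArg φ (h j hj)

theorem IsColoring.congr {w : List Piece} {f g : ℕ → ℕ → α} (hf : IsColoring w f)
    (h : ∀ k ≤ w.length, g k = f k) : IsColoring w g := by
  intro k p hp
  have hk := (List.getElem?_eq_some_iff.1 hp).1
  rw [h k hk.le, h (k + 1) hk]
  exact hf k p hp

theorem IsColoring.eq_of_segment {w : List Piece} {f : ℕ → ℕ → α} (hf : IsColoring w f)
    {x y : ℕ × ℕ} (hs : Segment w x y) (hx : Valid w x.1 x.2) (hy : Valid w y.1 y.2) :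
    f x.1 x.2 = f y.1 y.2 := by
  cases hs with
  | cupLeft h hj => simpa only [skip_of_lt hj] using ((hf _ _ h).1 _ hx.2).symm
  | cupRight h hj => simpa only [skip_of_le hj] using ((hf _ _ h).1 _ hx.2).symm
  | cupArc h => exact (hf _ _ h).2
  | @capLeft _ _ j h hj =>
    simpa only [skip_of_lt hj] using ((hf _ _ h).1 j (hy.2.trans_eq (widthAt_succ h))).symm
  | @capRight _ _ j h hj =>
    simpa only [skip_of_le hj] using ((hf _ _ h).1 j (hy.2.trans_eq (widthAt_succ h))).symm
  | capArc h => exact (hf _ _ h).2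
  | virtSide h h₀ h₁ =>
    simpa only [Equiv.swap_apply_of_ne_of_ne h₀ h₁] using (hf _ _ h _ hx.2).symm
  | @virtRight _ i h =>
    simpa only [Equiv.swap_apply_right] using
      (hf _ _ h (i + 1) (hy.2.trans_eq (widthAt_succ h))).symm
  | @virtLeft _ i h =>
    simpa only [Equiv.swap_apply_left] using (hf _ _ h i (hy.2.trans_eq (widthAt_succ h))).symm

/-- The colouring of a diagram without classical crossings by its closed curves; positions where
there is no strand get the colour `none`. -/
def component (w : List Piece) (k j : ℕ) :
    Option (Quot fun x y : Point w => Segment w x.1 y.1) :=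
  if h : k ≤ w.length ∧ j < widthAt w k then some (Quot.mk _ ⟨(k, j), h⟩) else none

theorem component_of_valid {w : List Piece} {k j : ℕ} (h : Valid w k j) :
    component w k j = some (Quot.mk _ ⟨(k, j), h⟩) :=
  dif_pos h

theorem component_eq_of_segment {w : List Piece} {x y : ℕ × ℕ} (hs : Segment w x y)
    (hx : Valid w x.1 x.2) (hy : Valid w y.1 y.2) :
    component w x.1 x.2 = component w y.1 y.2 := by
  rw [component_of_valid hx, component_of_valid hy]
  exact congrArg some (Quot.sound hs)

theorem isColoring_component {w : List Piece} (hw : WellFormed w) :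
    IsColoring w (component w) := by
  intro k p hp
  have hfit := hw k p hp
  have hk := (List.getElem?_eq_some_iff.1 hp).1
  have hwidth := widthAt_succ hp
  have below {j : ℕ} (hj : j < widthAt w k) : Valid w k j := ⟨hk.le, hj⟩
  have above {j : ℕ} (hj : j < p.width (widthAt w k)) : Valid w (k + 1) j := ⟨hk, hwidth ▸ hj⟩
  cases p with
  | cup i =>
    simp only [Piece.Fits, Piece.width] at hfit above
    refine ⟨fun j hj => ?_, component_eq_of_segment (.cupArc hp) (above (by omega))
      (above (by omega))⟩
    obtain hi | hi := lt_or_ge j i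
    · rw [skip_of_lt hi]
      exact (component_eq_of_segment (.cupLeft hp hi) (below hj) (above (by omega))).symm
    · rw [skip_of_le hi]
      exact (component_eq_of_segment (.cupRight hp hi) (below hj) (above (by omega))).symm
  | cap i =>
    simp only [Piece.Fits, Piece.width] at hfit above
    refine ⟨fun j hj => ?_, component_eq_of_segment (.capArc hp) (below (by omega))
      (below (by omega))⟩
    obtain hi | hi := lt_or_ge j i
    · rw [skip_of_lt hi]
      exact (component_eq_of_segment (.capLeft hp hi) (below (by omega)) (above hj)).symm
    · rw [skip_of_le hi]
      exact (component_eq_of_segment (.capRight hp hi) (below (by omega)) (above hj)).symm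
  | virt i =>
    simp only [Piece.Fits, Piece.width] at hfit above
    intro j hj
    obtain rfl | h₀ := eq_or_ne j i
    · rw [Equiv.swap_apply_left]
      exact (component_eq_of_segment (.virtLeft hp) (below (by omega)) (above hj)).symm
    obtain rfl | h₁ := eq_or_ne j (i + 1)
    · rw [Equiv.swap_apply_right]
      exact (component_eq_of_segment (.virtRight hp) (below (by omega)) (above hj)).symm
    · rw [Equiv.swap_apply_of_ne_of_ne h₀ h₁]
      exact (component_eq_of_segment (.virtSide hp h₀ h₁) (below hj) (above hj)).symm

/-- `f` is a colouring with the set of colours `S` in which different closed curves have different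
colours. -/
structure IsFinest (w : List Piece) (f : ℕ → ℕ → ℕ) (S : Finset ℕ) : Prop where
  isColoring : IsColoring w f
  mem_iff : ∀ c, c ∈ S ↔ ∃ k j, Valid w k j ∧ f k j = c
  eq_of_eq : ∀ {α : Type} {g : ℕ → ℕ → α}, IsColoring w g → ∀ {k j k' j' : ℕ},
    Valid w k j → Valid w k' j' → f k j = f k' j' → g k j = g k' j'

theorem IsFinest.curves_eq_card {w : List Piece} {f : ℕ → ℕ → ℕ} {S : Finset ℕ}
    (hf : IsFinest w f S) (hw : WellFormed w) : curves w = S.card := by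
  let color : (Quot fun x y : Point w => Segment w x.1 y.1) → S :=
    Quot.lift (fun x => ⟨f x.1.1 x.1.2, (hf.mem_iff _).2 ⟨_, _, x.2, rfl⟩⟩) fun x y hs =>
      Subtype.ext (hf.isColoring.eq_of_segment hs x.2 y.2)
  have color_bijective : color.Bijective := by
    constructor
    · rintro ⟨x⟩ ⟨y⟩ hxy
      have h := hf.eq_of_eq (isColoring_component hw) x.2 y.2 (congrArg Subtype.val hxy)
      rw [component_of_valid x.2, component_of_valid y.2] at h
      exact Option.some.inj h
    · rintro ⟨c, hc⟩
      obtain ⟨k, j, hkj, rfl⟩ := (hf.mem_iff c).1 hc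
      exact ⟨Quot.mk _ ⟨(k, j), hkj⟩, rfl⟩
  rw [curves, Nat.card_eq_of_bijective color color_bijective, Nat.card_eq_finsetCard]

theorem Piece.exists_below {p : Piece} {n j : ℕ} (hp : p.Fits n) (hj : j < p.width n) :
    (∃ j' < n, ∀ {α : Type} {a b : ℕ → α}, p.Compatible n a b → b j = a j') ∨
      ∃ i, p = .cup i ∧ ∀ {α : Type} {a b : ℕ → α}, p.Compatible n a b → b j = b i := by
  cases p with
  | cup i =>
    simp only [Fits, width] at hp hj
    obtain hlt | rfl | rfl | hgt : j < i ∨ j = i ∨ j = i + 1 ∨ i + 2 ≤ j := by omega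
    · refine .inl ⟨j, by omega, fun h => ?_⟩
      rw [← h.1 j (by omega), skip_of_lt hlt]
    · exact .inr ⟨j, rfl, fun _ => rfl⟩
    · exact .inr ⟨i, rfl, fun h => h.2.symm⟩
    · refine .inl ⟨j - 2, by omega, fun h => ?_⟩
      rw [← h.1 (j - 2) (by omega), skip_of_le (by omega), Nat.sub_add_cancel (by omega)]
  | cap i =>
    simp only [width] at hj
    exact .inl ⟨skip i j, by rw [skip]; split_ifs <;> omega, fun h => h.1 j hj⟩
  | virt i =>
    simp only [Fits, width] at hp hj
    refine .inl ⟨Equiv.swap i (i + 1) j, ?_, fun h => h j hj⟩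
    rw [Equiv.swap_apply_def]
    split_ifs <;> omega

theorem exists_valid_of_concat {u : List Piece} {p : Piece} (hp : p.Fits (widthAt u u.length))
    {k j : ℕ} (hkj : Valid (u ++ [p]) k j) :
    (∃ k' j', Valid u k' j' ∧
        ∀ {α : Type} {g : ℕ → ℕ → α}, IsColoring (u ++ [p]) g → g k j = g k' j') ∨
      ∃ i, p = .cup i ∧
        ∀ {α : Type} {g : ℕ → ℕ → α}, IsColoring (u ++ [p]) g → g k j = g (u.length + 1) i := by
  obtain hkj | ⟨rfl, hj⟩ := valid_concat.1 hkj
  · exact .inl ⟨k, j, hkj, fun _ => rfl⟩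
  · exact (Piece.exists_below hp hj).imp
      (fun ⟨j', hj', h⟩ => ⟨u.length, j', ⟨le_rfl, hj'⟩, fun hg => h (isColoring_concat.1 hg).2⟩)
      (fun ⟨i, hi, h⟩ => ⟨i, hi, fun hg => h (isColoring_concat.1 hg).2⟩)

section Extension

variable [DecidableEq α]

/-- How the colours change when a piece is put on top of strands with the colours `c`: a maximum
turns the first of the two colours it joins into the second one. -/
def Piece.glue (c : ℕ → α) : Piece → α → α
  | .cap i => Function.update id (c i) (c (i + 1))
  | _ => id

/-- The colours above a piece that is put on top of strands with the colours `c`; a minimum gets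
the colour `x`. -/
def Piece.next (x : α) (c : ℕ → α) : Piece → ℕ → α
  | .cup i, j => if j < i then c j else if j < i + 2 then x else c (j - 2)
  | .cap i, j => (Piece.cap i).glue c (c (skip i j))
  | .virt i, j => c (Equiv.swap i (i + 1) j)

/-- The colours of the new closed curves that start at a piece. -/
def Piece.fresh (x : α) : Piece → Finset α
  | .cup _ => {x}
  | _ => ∅

/-- The number of closed curves that a piece completes when it is put on top of strands with the
colours `c`. -/
def Piece.loops (c : ℕ → α) : Piece → ℕ
  | .cap i => if c i = c (i + 1) then 1 else 0
  | _ => 0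

/-- The colouring of `u ++ [p]` that arises from the colouring `f` of `u`. -/
def extend (u : List Piece) (f : ℕ → ℕ → α) (p : Piece) (x : α) : ℕ → ℕ → α :=
  Function.update (fun k j => p.glue (f u.length) (f k j)) (u.length + 1)
    (p.next x (f u.length))

theorem extend_of_le {u : List Piece} {k : ℕ} (hk : k ≤ u.length) (f : ℕ → ℕ → α) (p : Piece)
    (x : α) (j : ℕ) : extend u f p x k j = p.glue (f u.length) (f k j) := by
  rw [extend, Function.update_of_ne (by omega)]

theorem extend_length_add_one (u : List Piece) (f : ℕ → ℕ → α) (p : Piece) (x : α) :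
    extend u f p x (u.length + 1) = p.next x (f u.length) :=
  Function.update_self _ _ _

theorem extend_cup (u : List Piece) (f : ℕ → ℕ → α) (i : ℕ) (x : α) :
    extend u f (.cup i) x (u.length + 1) i = x := by
  simp [extend_length_add_one, Piece.next]

theorem Piece.compatible_next (n : ℕ) (p : Piece) (x : α) (c : ℕ → α) :
    p.Compatible n (fun j => p.glue c (c j)) (p.next x c) := by
  cases p with
  | cup i =>
    refine ⟨fun j _ => ?_, by simp [next]⟩
    obtain hj | hj := lt_or_ge j i
    · simp [next, glue, skip_of_lt hj, hj]
    · simp [next, glue, skip_of_le hj, show ¬ j + 2 < i by omega, hj.not_gt]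
  | cap i =>
    refine ⟨fun j _ => rfl, ?_⟩
    obtain h | h := eq_or_ne (c (i + 1)) (c i) <;> simp [glue, h]
  | virt i => exact fun j _ => rfl

theorem IsColoring.extend {u : List Piece} {f : ℕ → ℕ → α} (hf : IsColoring u f) (p : Piece)
    (x : α) : IsColoring (u ++ [p]) (extend u f p x) := by
  refine isColoring_concat.2 ⟨(hf.map (p.glue (f u.length))).congr fun k hk =>
    funext (extend_of_le hk f p x), ?_⟩
  rw [funext (extend_of_le le_rfl f p x), extend_length_add_one]
  exact p.compatible_next _ x _

end Extension

theorem IsFinest.eq_of_glue_eq {u : List Piece} {f : ℕ → ℕ → ℕ} {S : Finset ℕ}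
    (hf : IsFinest u f S) {p : Piece} (hp : p.Fits (widthAt u u.length)) {α : Type}
    {g : ℕ → ℕ → α} (hg : IsColoring (u ++ [p]) g) {k j k' j' : ℕ} (hkj : Valid u k j)
    (hkj' : Valid u k' j')
    (h : p.glue (f u.length) (f k j) = p.glue (f u.length) (f k' j')) : g k j = g k' j' := by
  obtain ⟨hg', hcompat⟩ := isColoring_concat.1 hg
  cases p with
  | cup i | virt i => exact hf.eq_of_eq hg' hkj hkj' h
  | cap i =>
    simp only [Piece.Fits] at hp
    have eq_left {k j : ℕ} (hkj : Valid u k j) (h : f k j = f u.length i) :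
        g k j = g u.length i := hf.eq_of_eq hg' hkj ⟨le_rfl, by omega⟩ h
    have eq_right {k j : ℕ} (hkj : Valid u k j) (h : f k j = f u.length (i + 1)) :
        g k j = g u.length i :=
      (hf.eq_of_eq hg' hkj ⟨le_rfl, by omega⟩ h).trans hcompat.2.symm
    simp only [Piece.glue, Function.update_apply, id] at h
    split_ifs at h with h₁ h₂ h₂
    · rw [eq_left hkj h₁, eq_left hkj' h₂]
    · rw [eq_left hkj h₁, eq_right hkj' h.symm]
    · rw [eq_right hkj h, eq_left hkj' h₂]
    · exact hf.eq_of_eq hg' hkj hkj' h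

theorem IsFinest.mem_iff_extend {u : List Piece} {f : ℕ → ℕ → ℕ} {S : Finset ℕ}
    (hf : IsFinest u f S) {p : Piece} (hp : p.Fits (widthAt u u.length)) (x c : ℕ) :
    c ∈ p.fresh x ∪ S.image (p.glue (f u.length)) ↔
      ∃ k j, Valid (u ++ [p]) k j ∧ extend u f p x k j = c := by
  have hext := hf.isColoring.extend p x
  constructor
  · intro hc
    obtain hc | hc := Finset.mem_union.1 hc
    · cases p with
      | cap i | virt i => simp [Piece.fresh] at hc
      | cup i =>
        obtain rfl := Finset.mem_singleton.1 hc
        have hi : i < widthAt u u.length + 2 := Nat.lt_add_right 1 (Nat.lt_succ_of_le hp)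
        exact ⟨u.length + 1, i, valid_concat.2 (.inr ⟨rfl, hi⟩), extend_cup u f i c⟩
    · obtain ⟨_, h, rfl⟩ := Finset.mem_image.1 hc
      obtain ⟨k, j, hkj, rfl⟩ := (hf.mem_iff _).1 h
      exact ⟨k, j, valid_concat.2 (.inl hkj), extend_of_le hkj.1 f p x j⟩
  · rintro ⟨k, j, hkj, rfl⟩
    obtain ⟨k', j', hkj', h⟩ | ⟨i, rfl, h⟩ := exists_valid_of_concat hp hkj
    · rw [h hext, extend_of_le hkj'.1]
      exact Finset.mem_union_right _
        (Finset.mem_image_of_mem _ ((hf.mem_iff _).2 ⟨_, _, hkj', rfl⟩))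
    · rw [h hext, extend_cup]
      exact Finset.mem_union_left _ (Finset.mem_singleton_self x)

theorem IsFinest.eq_of_extend_eq {u : List Piece} {f : ℕ → ℕ → ℕ} {S : Finset ℕ}
    (hf : IsFinest u f S) {p : Piece} (hp : p.Fits (widthAt u u.length)) {x : ℕ} (hx : x ∉ S)
    {α : Type} {g : ℕ → ℕ → α} (hg : IsColoring (u ++ [p]) g) {k j k' j' : ℕ}
    (hkj : Valid (u ++ [p]) k j) (hkj' : Valid (u ++ [p]) k' j')
    (h : extend u f p x k j = extend u f p x k' j') : g k j = g k' j' := by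
  have hext := hf.isColoring.extend p x
  have old_ne_new {i k j : ℕ} (hi : p = .cup i) (hv : Valid u k j) :
      extend u f p x k j ≠ extend u f p x (u.length + 1) i := by
    subst hi
    rw [extend_of_le hv.1, extend_cup]
    exact fun h => hx (h ▸ (hf.mem_iff _).2 ⟨k, j, hv, rfl⟩)
  obtain ⟨k₁, j₁, hv, h₁⟩ | ⟨i, hi, h₁⟩ := exists_valid_of_concat hp hkj <;>
    obtain ⟨k₂, j₂, hv', h₂⟩ | ⟨i', hi', h₂⟩ := exists_valid_of_concat hp hkj' <;>
    rw [h₁ hext, h₂ hext] at h <;> rw [h₁ hg, h₂ hg]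
  · rw [extend_of_le hv.1, extend_of_le hv'.1] at h
    exact hf.eq_of_glue_eq hp hg hv hv' h
  · exact absurd h (old_ne_new hi' hv)
  · exact absurd h.symm (old_ne_new hi hv')
  · rw [Piece.cup.inj (hi.symm.trans hi')]

theorem IsFinest.concat {u : List Piece} {f : ℕ → ℕ → ℕ} {S : Finset ℕ} (hf : IsFinest u f S)
    {p : Piece} (hp : p.Fits (widthAt u u.length)) {x : ℕ} (hx : x ∉ S) :
    IsFinest (u ++ [p]) (extend u f p x) (p.fresh x ∪ S.image (p.glue (f u.length))) where
  isColoring := hf.isColoring.extend p x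
  mem_iff := hf.mem_iff_extend hp x
  eq_of_eq := hf.eq_of_extend_eq hp hx

end Colorings

/-! ### How strands are joined below -/

section Patterns

variable {α β γ : Type*} {n : ℕ} {c : ℕ → α} {c' : ℕ → β}

/-- The colours `c` and `c'` of `n` strands induce the same partition of the strands. -/
def SamePattern (n : ℕ) (c : ℕ → α) (c' : ℕ → β) : Prop :=
  ∀ i < n, ∀ j < n, (c i = c j ↔ c' i = c' j)

theorem SamePattern.trans {c'' : ℕ → γ} (h : SamePattern n c c') (h' : SamePattern n c' c'') :
    SamePattern n c c'' :=
  fun i hi j hj => (h i hi j hj).trans (h' i hi j hj)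

variable [DecidableEq α] [DecidableEq β]

theorem SamePattern.loops_eq (h : SamePattern n c c') {p : Piece} (hp : p.Fits n) :
    p.loops c = p.loops c' := by
  cases p with
  | cup i | virt i => rfl
  | cap i =>
    simp only [Piece.Fits] at hp
    exact if_congr (h i (by omega) (i + 1) (by omega)) rfl rfl

theorem SamePattern.next (h : SamePattern n c c') {p : Piece} (hp : p.Fits n) {x : α} {x' : β}
    (hx : ∀ i < n, c i ≠ x) (hx' : ∀ i < n, c' i ≠ x') :
    SamePattern (p.width n) (p.next x c) (p.next x' c') := by
  intro a ha b hb
  cases p with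
  | cup i =>
    simp only [Piece.Fits, Piece.width] at hp ha hb
    have old_new {j : ℕ} (hj : j < n) : c j = x ↔ c' j = x' := iff_of_false (hx j hj) (hx' j hj)
    have new_old {j : ℕ} (hj : j < n) : x = c j ↔ x' = c' j :=
      iff_of_false (hx j hj).symm (hx' j hj).symm
    simp only [Piece.next]
    split_ifs
    all_goals first
      | exact h _ (by omega) _ (by omega)
      | exact old_new (by omega)
      | exact new_old (by omega)
      | simp
  | cap i =>
    simp only [Piece.Fits, Piece.width] at hp ha hb
    have skip_lt {j : ℕ} (hj : j < n - 2) : skip i j < n := by rw [skip]; split_ifs <;> omega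
    have hi : i < n := by omega
    have hi' : i + 1 < n := by omega
    simp only [Piece.next, Piece.glue, Function.update_apply, id,
      h _ (skip_lt ha) _ hi, h _ (skip_lt hb) _ hi]
    split_ifs
    · simp
    · exact h _ hi' _ (skip_lt hb)
    · exact h _ (skip_lt ha) _ hi'
    · exact h _ (skip_lt ha) _ (skip_lt hb)
  | virt i =>
    simp only [Piece.Fits, Piece.width] at hp ha hb
    have swap_lt {j : ℕ} (hj : j < n) : Equiv.swap i (i + 1) j < n := by
      rw [Equiv.swap_apply_def]; split_ifs <;> omega
    exact h _ (swap_lt ha) _ (swap_lt hb)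

theorem image_update_id {S : Finset α} {a b : α} (hb : b ∈ S) (hba : b ≠ a) :
    S.image (Function.update id a b) = S.erase a := by
  ext y
  simp only [Finset.mem_image, Finset.mem_erase, Function.update_apply, id]
  constructor
  · rintro ⟨s, hs, rfl⟩
    split_ifs with hsa
    · exact ⟨hba, hb⟩
    · exact ⟨hsa, hs⟩
  · rintro ⟨hya, hy⟩
    exact ⟨y, hy, if_neg hya⟩

theorem Piece.card_fresh_union_image_glue {p : Piece} (hp : p.Fits n) {S : Finset α}
    (hc : ∀ i < n, c i ∈ S) {x : α} (hx : x ∉ S) :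
    2 * (p.fresh x ∪ S.image (p.glue c)).card + n = 2 * S.card + 2 * p.loops c + p.width n := by
  cases p with
  | cup i =>
    simp only [fresh, glue, loops, width, Finset.image_id, Finset.singleton_union,
      Finset.card_insert_of_notMem hx]
    omega
  | virt i => simp [fresh, glue, loops, width]
  | cap i =>
    simp only [Fits] at hp
    simp only [fresh, glue, loops, width, Finset.empty_union]
    have hi := hc i (by omega)
    split_ifs with h
    · rw [← h, show Function.update id (c i) (c i) = id from Function.update_eq_self _ _,
        Finset.image_id]
      omega
    · rw [image_update_id (hc _ (by omega)) (Ne.symm h)]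
      have := Finset.card_erase_add_one hi
      omega

/-- The partition of `n` strands by the colours `c` as a list: every strand is labelled by the
leftmost strand of the same colour. -/
def normalForm (n : ℕ) (c : ℕ → α) : List ℕ :=
  (List.range n).map fun j => ((List.range n).map c).idxOf (c j)

theorem length_normalForm (n : ℕ) (c : ℕ → α) : (normalForm n c).length = n := by
  simp [normalForm]

theorem samePattern_normalForm (n : ℕ) (c : ℕ → α) :
    SamePattern n c fun j => (normalForm n c)[j]? := by
  intro i hi j hj
  have mem {k : ℕ} (hk : k < n) : c k ∈ (List.range n).map c :=
    List.mem_map_of_mem (List.mem_range.2 hk)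
  simp only [normalForm, List.getElem?_map, List.getElem?_range, hi, hj, Option.map_some,
    Option.some.injEq]
  exact (List.idxOf_inj (mem hi)).symm

end Patterns

/-- The labels above a piece that is put on top of strands with the labels `m`. -/
def Piece.act (p : Piece) (m : List ℕ) : List ℕ :=
  normalForm (p.width m.length) (p.next none fun j => m[j]?)

theorem Piece.length_act (p : Piece) (m : List ℕ) : (p.act m).length = p.width m.length :=
  length_normalForm _ _

/-- In the lower part `u` of a diagram without classical crossings, strands at the top belong to
the same curve if and only if their labels in `m` agree, and `l` curves are closed.  As every
other curve is an arc with two ends at the top, this is a condition on the number of colours. -/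
structure Tracks (u : List Piece) (m : List ℕ) (l : ℕ) : Prop where
  wellFormed : WellFormed u
  widthAt_length : widthAt u u.length = m.length
  exists_isFinest : ∃ f S, IsFinest u f S ∧ 2 * S.card = 2 * l + m.length ∧
    SamePattern m.length (f u.length) fun j => m[j]?

theorem tracks_nil : Tracks [] [] 0 where
  wellFormed := by simp [WellFormed]
  widthAt_length := rfl
  exists_isFinest := by
    have not_valid {k j : ℕ} : ¬ Valid [] k j := by simp [Valid, widthAt]
    exact ⟨fun _ _ => 0, ∅, ⟨by simp [IsColoring], by simp [not_valid],
      fun _ _ _ _ _ h => (not_valid h).elim⟩, rfl, by simp [SamePattern]⟩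

theorem Tracks.concat {u : List Piece} {m : List ℕ} {l : ℕ} (h : Tracks u m l) {p : Piece}
    (hp : p.Fits m.length) : Tracks (u ++ [p]) (p.act m) (l + p.loops fun j => m[j]?) := by
  obtain ⟨hu, hm, f, S, hf, hcard, hpattern⟩ := h
  have hp' : p.Fits (widthAt u u.length) := hm ▸ hp
  obtain ⟨x, hx⟩ := Infinite.exists_notMem_finset S
  have label_mem (j : ℕ) (hj : j < m.length) : f u.length j ∈ S :=
    (hf.mem_iff _).2 ⟨u.length, j, ⟨le_rfl, hm ▸ hj⟩, rfl⟩
  refine ⟨wellFormed_concat.2 ⟨hu, hp'⟩, ?_, _, _, hf.concat hp' hx, ?_, ?_⟩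
  · rw [List.length_append, List.length_singleton, widthAt_concat, hm, p.length_act]
  · have := p.card_fresh_union_image_glue hp label_mem hx
    rw [← hpattern.loops_eq hp, p.length_act]
    omega
  · rw [List.length_append, List.length_singleton, extend_length_add_one, p.length_act]
    exact (hpattern.next hp (fun j hj => ne_of_mem_of_not_mem (label_mem j hj) hx)
      (by simp)).trans (samePattern_normalForm _ _)

theorem Tracks.curves_eq {u : List Piece} {l : ℕ} (h : Tracks u [] l) : curves u = l := by
  obtain ⟨hu, -, f, S, hf, hcard, -⟩ := h
  rw [hf.curves_eq_card hu]
  simpa using hcard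

/-! ### The state sum -/

/-- The exponent of `A` contributed by a smoothing. -/
def Smoothing.sign : Smoothing → ℤ
  | .alpha => 1
  | .beta => -1

theorem Smoothing.sum_univ {M : Type*} [AddCommMonoid M] (g : Smoothing → M) :
    ∑ a, g a = g .alpha + g .beta :=
  Finset.sum_pair (by decide)

theorem Diagram.State.c_eq_sum {D : Diagram} (s : D.State) : s.c = ∑ k, (s k).sign := by
  rw [c, Finset.card_filter, Finset.card_filter]
  push_cast
  rw [← Finset.sum_sub_distrib]
  refine Finset.sum_congr rfl fun k _ => ?_
  cases s k <;> simp [Smoothing.sign]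

/-- The state sum `∑ₛ A ^ c(s) d ^ |s|` of the upper part `w` of a diagram, where strands with the
same label in `m` are joined below; only the curves completed by `w` are counted. -/
noncomputable def stateSum : List Slice → List ℕ → LaurentPolynomial ℤ
  | [], _ => 1
  | .plain p :: w, m => d ^ p.loops (m[·]?) * stateSum w (p.act m)
  | .over i :: w, m => T 1 * stateSum w m +
      T (-1) * (d ^ (Piece.cap i).loops (m[·]?) *
        stateSum w ((Piece.cup i).act ((Piece.cap i).act m)))
  | .under i :: w, m => T (-1) * stateSum w m +
      T 1 * (d ^ (Piece.cap i).loops (m[·]?) *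
        stateSum w ((Piece.cup i).act ((Piece.cap i).act m)))

theorem sum_states_succ {n : ℕ} (F : Smoothing → (Fin n → Smoothing) → LaurentPolynomial ℤ) :
    ∑ s : Fin (n + 1) → Smoothing, T (∑ k, (s k).sign) * F (s 0) (fun k => s k.succ) =
      T 1 * ∑ s : Fin n → Smoothing, T (∑ k, (s k).sign) * F .alpha s +
      T (-1) * ∑ s : Fin n → Smoothing, T (∑ k, (s k).sign) * F .beta s := by
  rw [← (Fin.consEquiv fun _ : Fin (n + 1) => Smoothing).sum_comp, Fintype.sum_prod_type,
    Smoothing.sum_univ]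
  simp [Fin.consEquiv, Fin.sum_univ_succ, T_add, -T_mul, Smoothing.sign, Finset.mul_sum, mul_assoc]

theorem Piece.length_act_cup_act_cap {i : ℕ} {m : List ℕ} (hi : i + 2 ≤ m.length) :
    ((Piece.cup i).act ((Piece.cap i).act m)).length = m.length := by
  simp only [length_act, width]
  omega

theorem Tracks.cap_cup {u : List Piece} {m : List ℕ} {l i : ℕ} (h : Tracks u m l)
    (hi : i + 2 ≤ m.length) :
    Tracks (u ++ [.cap i, .cup i]) ((Piece.cup i).act ((Piece.cap i).act m))
      (l + (Piece.cap i).loops (m[·]?)) := by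
  have h' := (h.concat (p := .cap i) hi).concat (p := .cup i)
    (by simp only [Piece.Fits, Piece.length_act, Piece.width]; omega)
  rwa [List.append_assoc] at h'

theorem sum_states_eq_stateSum (w : List Slice) {u : List Piece} {m : List ℕ} {l : ℕ}
    (h : Tracks u m l) (hw : ClosesFrom m.length w) :
    ∑ s : Fin (crossings w) → Smoothing, T (∑ k, (s k).sign) * d ^ curves (u ++ smooth w s) =
      d ^ l * stateSum w m := by
  induction w generalizing u m l with
  | nil =>
    obtain rfl : m = [] := List.length_eq_zero_iff.1 hw
    change ∑ s : Fin 0 → Smoothing, T (∑ k : Fin 0, (s k).sign) * d ^ curves (u ++ []) = _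
    simp [stateSum, h.curves_eq]
  | cons a w ih =>
    rcases a with p | i | i
    · obtain ⟨hp, hw⟩ := hw
      have sum_eq := ih (h.concat hp) (by rwa [p.length_act])
      simp only [List.append_assoc, List.singleton_append] at sum_eq
      refine sum_eq.trans ?_
      rw [pow_add, mul_assoc, stateSum]
    · obtain ⟨hi, hw⟩ := hw
      have sum_turnback := ih (h.cap_cup hi) (by rwa [Piece.length_act_cup_act_cap hi])
      refine (sum_states_succ fun a s =>
        d ^ curves (u ++ (smoothOver i a ++ smooth w s))).trans ?_
      simp only [smoothOver, List.nil_append, ← List.append_assoc, ih h hw, sum_turnback, stateSum]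
      ring
    · obtain ⟨hi, hw⟩ := hw
      have sum_turnback := ih (h.cap_cup hi) (by rwa [Piece.length_act_cup_act_cap hi])
      refine (sum_states_succ fun a s =>
        d ^ curves (u ++ (smoothUnder i a ++ smooth w s))).trans ?_
      simp only [smoothUnder, List.nil_append, ← List.append_assoc, ih h hw, sum_turnback, stateSum]
      ring

instance (w : List Piece) : Finite (Point w) := by
  refine Set.Finite.subset (s := ⋃ k ∈ Set.Iic w.length, Prod.mk k '' Set.Iio (widthAt w k))
    ((Set.finite_Iic _).biUnion fun k _ => (Set.finite_Iio _).image _) fun x hx => ?_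
  exact Set.mem_biUnion hx.1 ⟨x.2, hx.2, rfl⟩

theorem curves_pos {w : List Piece} {k j : ℕ} (h : Valid w k j) : 0 < curves w := by
  have : Nonempty (Quot fun x y : Point w => Segment w x.1 y.1) :=
    .intro (Quot.mk _ ⟨(k, j), h⟩)
  exact Nat.card_pos

theorem Diagram.exists_word_eq_cup (D : Diagram) : ∃ i w, D.word = .plain (.cup i) :: w := by
  obtain ⟨_ | ⟨(i | _ | _) | _ | _, w⟩, hne, hw⟩ := D
  · exact absurd rfl hne
  · exact ⟨i, w, rfl⟩
  all_goals exact absurd hw.1 (Nat.not_succ_le_zero _)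

theorem Diagram.curves_smooth_pos (D : Diagram) (s : D.State) : 0 < curves (smooth D.word s) := by
  obtain ⟨i, w, hD⟩ := D.exists_word_eq_cup
  obtain ⟨_, _, _⟩ := D
  cases hD
  exact curves_pos (k := 1) (j := 0) (by simp [smooth, Valid, widthAt, Piece.width])

theorem d_mul_bracket (D : Diagram) : d * D.bracket = stateSum D.word [] := by
  rw [← one_mul (stateSum _ _), ← pow_zero d, ← sum_states_eq_stateSum D.word tracks_nil D.closed,
    Diagram.bracket, Finset.mul_sum]
  refine Finset.sum_congr rfl fun s _ => ?_
  rw [s.c_eq_sum, List.nil_append, mul_left_comm, mul_pow_sub_one (D.curves_smooth_pos s).ne']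

theorem d_ne_zero : d ≠ 0 := by
  intro h
  have eval_one := congrArg (eval₂ (RingHom.id ℤ) 1) h
  simp [d] at eval_one

theorem bracket_eq_one {D : Diagram} (h : stateSum D.word [] = d) : D.bracket = 1 :=
  mul_left_cancel₀ d_ne_zero (by rw [d_mul_bracket, h, mul_one])

/-! ### Two and four strands -/

/-- The smoothing of a crossing of the strands `i` and `i + 1` by a maximum below a minimum. -/
def turnback (i : ℕ) : List Slice := [.plain (.cap i), .plain (.cup i)]

/-- The labels of two strands that are joined below. -/
def single : List ℕ := [0, 0]

/-- The labels of four strands when the first is joined below to the third and the second to the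
fourth. -/
def crossed : List ℕ := [0, 1, 0, 1]

/-- The labels of four strands in the three ways of joining them in pairs below. -/
def pairings : List (List ℕ) := [[0, 0, 2, 2], crossed, [0, 1, 1, 0]]

theorem crossed_mem_pairings : crossed ∈ pairings := by
  decide

theorem act_cup_zero_nil : (Piece.cup 0).act [] = single := by
  decide

theorem act_cup_zero_single : (Piece.cup 0).act single = (Piece.cup 2).act single := by
  decide

theorem act_virt_act_cup_single : (Piece.virt 1).act ((Piece.cup 2).act single) = crossed := by
  decide

theorem act_cup_single_mem_pairings : ∀ i < 3, (Piece.cup i).act single ∈ pairings := by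
  decide

theorem act_cap_pairing : ∀ m ∈ pairings, ∀ i < 3, (Piece.cap i).act m = single := by
  decide

theorem loops_cap_zero_eq_loops_cap_two :
    ∀ m ∈ pairings, (Piece.cap 0).loops (m[·]?) = (Piece.cap 2).loops (m[·]?) := by
  decide

theorem loops_cap_act_cup_single : ∀ i < 3, ∀ j < 3,
    (Piece.cap i).loops (((Piece.cup j).act single)[·]?) =
      if i = j ∨ i + 2 = j ∨ j + 2 = i then 1 else 0 := by
  decide

theorem loops_cap_crossed : ∀ i < 3, (Piece.cap i).loops (crossed[·]?) = 0 := by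
  decide

section StateSum

variable {m : List ℕ} {i j : ℕ}

theorem stateSum_cup (i : ℕ) (w : List Slice) (m : List ℕ) :
    stateSum (.plain (.cup i) :: w) m = stateSum w ((Piece.cup i).act m) := by
  simp [stateSum, Piece.loops]

theorem stateSum_turnback (i : ℕ) (w : List Slice) (m : List ℕ) :
    stateSum (turnback i ++ w) m = d ^ (Piece.cap i).loops (m[·]?) *
      stateSum w ((Piece.cup i).act ((Piece.cap i).act m)) := by
  rw [turnback, List.cons_append, stateSum, List.cons_append, stateSum_cup, List.nil_append]

theorem stateSum_over (i : ℕ) (w : List Slice) (m : List ℕ) :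
    stateSum (.over i :: w) m = T 1 * stateSum w m + T (-1) * stateSum (turnback i ++ w) m := by
  rw [stateSum, stateSum_turnback]

theorem stateSum_under (i : ℕ) (w : List Slice) (m : List ℕ) :
    stateSum (.under i :: w) m = T (-1) * stateSum w m + T 1 * stateSum (turnback i ++ w) m := by
  rw [stateSum, stateSum_turnback]

theorem stateSum_cap_pairing (hm : m ∈ pairings) (hi : i < 3) (w : List Slice) :
    stateSum (.plain (.cap i) :: w) m = d ^ (Piece.cap i).loops (m[·]?) * stateSum w single := by
  rw [stateSum, act_cap_pairing m hm i hi]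

theorem stateSum_turnback_pairing (hm : m ∈ pairings) (hi : i < 3) (w : List Slice) :
    stateSum (turnback i ++ w) m =
      d ^ (Piece.cap i).loops (m[·]?) * stateSum w ((Piece.cup i).act single) := by
  rw [stateSum_turnback, act_cap_pairing m hm i hi]

theorem stateSum_cap_cup_single (hi : i < 3) (w : List Slice) :
    stateSum (.plain (.cap i) :: w) ((Piece.cup i).act single) = d * stateSum w single := by
  rw [stateSum_cap_pairing (act_cup_single_mem_pairings i hi) hi,
    loops_cap_act_cup_single i hi i hi, if_pos (.inl rfl), pow_one]

theorem stateSum_zigzag (hi : i < 3) (hj : j < 3) (hij : i = j + 1 ∨ j = i + 1) (w : List Slice) :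
    stateSum (.plain (.cap i) :: w) ((Piece.cup j).act single) = stateSum w single := by
  rw [stateSum_cap_pairing (act_cup_single_mem_pairings j hj) hi,
    loops_cap_act_cup_single i hi j hj, if_neg (by omega), pow_zero, one_mul]

theorem stateSum_cap_crossed (hi : i < 3) (w : List Slice) :
    stateSum (.plain (.cap i) :: w) crossed = stateSum w single := by
  rw [stateSum_cap_pairing crossed_mem_pairings hi, loops_cap_crossed i hi, pow_zero, one_mul]

theorem stateSum_virt_act_cup_single (w : List Slice) :
    stateSum (.plain (.virt 1) :: w) ((Piece.cup 2).act single) = stateSum w crossed := by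
  simp [stateSum, act_virt_act_cup_single, Piece.loops]

theorem stateSum_cap_zero_single : stateSum [.plain (.cap 0)] single = d := by
  rw [stateSum, stateSum, mul_one, show (Piece.cap 0).loops (single[·]?) = 1 by decide, pow_one]

theorem stateSum_turnback_zero_eq_turnback_two (hm : m ∈ pairings) (w : List Slice) :
    stateSum (turnback 0 ++ w) m = stateSum (turnback 2 ++ w) m := by
  rw [stateSum_turnback_pairing hm (by norm_num), stateSum_turnback_pairing hm (by norm_num),
    loops_cap_zero_eq_loops_cap_two m hm]
  rfl

theorem stateSum_turnback_act_cup (hi : i < 3) (w : List Slice) :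
    stateSum (turnback i ++ w) ((Piece.cup i).act single) =
      d * stateSum w ((Piece.cup i).act single) := by
  rw [turnback, List.cons_append, stateSum_cap_cup_single hi, List.cons_append, stateSum_cup,
    List.nil_append]

theorem stateSum_turnback_zigzag (hi : i < 3) (hj : j < 3) (hij : i = j + 1 ∨ j = i + 1)
    (w : List Slice) :
    stateSum (turnback i ++ w) ((Piece.cup j).act single) =
      stateSum w ((Piece.cup i).act single) := by
  rw [turnback, List.cons_append, stateSum_zigzag hi hj hij, List.cons_append, stateSum_cup,
    List.nil_append]

end StateSum

theorem T_one_mul_T_neg_one : (T 1 * T (-1) : LaurentPolynomial ℤ) = 1 := by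
  rw [← T_add, add_neg_cancel, T_zero]

theorem d_eq : d = -T (-1) ^ 2 - T 1 ^ 2 := by
  simp [d, T_pow]

/-- The factor `-A⁻³` that a kink contributes to the state sum, as a unit of `ℤ[A, A⁻¹]`. -/
noncomputable def kink : (LaurentPolynomial ℤ)ˣ where
  val := -T (-1) ^ 3
  inv := -T 1 ^ 3
  val_inv := by rw [neg_mul_neg, mul_comm, ← mul_pow, T_one_mul_T_neg_one, one_pow]
  inv_val := by rw [neg_mul_neg, ← mul_pow, T_one_mul_T_neg_one, one_pow]

section Moves

variable {w w' : List Slice} {m : List ℕ} {i j : ℕ}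

theorem stateSum_over_eq_kink_mul (h : stateSum (turnback i ++ w) m = d * stateSum w m) :
    stateSum (.over i :: w) m = kink * stateSum w m := by
  rw [stateSum_over, h, d_eq, kink]
  linear_combination -T 1 * stateSum w m * T_one_mul_T_neg_one

theorem stateSum_under_eq_kink_inv_mul (h : stateSum (turnback i ++ w) m = d * stateSum w m) :
    stateSum (.under i :: w) m = ↑kink⁻¹ * stateSum w m := by
  rw [stateSum_under, h, d_eq, kink, Units.inv_mk]
  linear_combination -T (-1) * stateSum w m * T_one_mul_T_neg_one

theorem stateSum_turnback_cons (hm : m ∈ pairings) (hi : i < 3) {a : Slice}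
    {c : LaurentPolynomial ℤ} (ha : ∀ {m}, stateSum (turnback i ++ w) m = d * stateSum w m →
      stateSum (a :: w) m = c * stateSum w m) :
    stateSum (turnback i ++ a :: w) m = c * stateSum (turnback i ++ w) m := by
  rw [stateSum_turnback_pairing hm hi, stateSum_turnback_pairing hm hi,
    ha (stateSum_turnback_act_cup hi w)]
  ring

theorem stateSum_over_under (hm : m ∈ pairings) (hi : i < 3) (w : List Slice) :
    stateSum (.over i :: .under i :: w) m = stateSum w m := by
  rw [stateSum_over, stateSum_under, stateSum_turnback_cons hm hi stateSum_under_eq_kink_inv_mul,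
    kink, Units.inv_mk]
  linear_combination (stateSum w m - T 1 ^ 2 * stateSum (turnback i ++ w) m) * T_one_mul_T_neg_one

theorem stateSum_over_congr (hi : i < 3) (h : ∀ m ∈ pairings, stateSum w m = stateSum w' m)
    (hm : m ∈ pairings) : stateSum (.over i :: w) m = stateSum (.over i :: w') m := by
  rw [stateSum_over, stateSum_over, stateSum_turnback_pairing hm hi,
    stateSum_turnback_pairing hm hi, h m hm, h _ (act_cup_single_mem_pairings i hi)]

theorem stateSum_under_congr (hi : i < 3) (h : ∀ m ∈ pairings, stateSum w m = stateSum w' m)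
    (hm : m ∈ pairings) : stateSum (.under i :: w) m = stateSum (.under i :: w') m := by
  rw [stateSum_under, stateSum_under, stateSum_turnback_pairing hm hi,
    stateSum_turnback_pairing hm hi, h m hm, h _ (act_cup_single_mem_pairings i hi)]

theorem stateSum_over_zero_eq_over_two (hm : m ∈ pairings) (w : List Slice) :
    stateSum (.over 0 :: w) m = stateSum (.over 2 :: w) m := by
  rw [stateSum_over, stateSum_over, stateSum_turnback_zero_eq_turnback_two hm]

theorem stateSum_over_zero_under_two (hm : m ∈ pairings) (w : List Slice) :
    stateSum (.over 0 :: .under 2 :: w) m = stateSum w m := by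
  rw [stateSum_over_zero_eq_over_two hm, stateSum_over_under hm (by norm_num)]

theorem stateSum_over_two_under_zero (hm : m ∈ pairings) (w : List Slice) :
    stateSum (.over 2 :: .under 0 :: w) m = stateSum w m := by
  rw [← stateSum_over_zero_eq_over_two hm, stateSum_over_under hm (by norm_num)]

theorem stateSum_turnback_cap (hm : m ∈ pairings) (hi : i < 3) (hj : j < 3)
    (hij : i = j + 1 ∨ j = i + 1) (w : List Slice) :
    stateSum (turnback j ++ .plain (.cap i) :: w) m = stateSum (.plain (.cap j) :: w) m := by
  rw [stateSum_turnback_pairing hm hj, stateSum_zigzag hi hj hij, stateSum_cap_pairing hm hj]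

theorem stateSum_under_under_cap (hm : m ∈ pairings) (hi : i < 3) (hj : j < 3)
    (hij : i = j + 1 ∨ j = i + 1) (w : List Slice) :
    stateSum (.under i :: .under j :: .plain (.cap i) :: w) m =
      stateSum (.plain (.cap j) :: w) m := by
  have hm' := act_cup_single_mem_pairings i hi
  rw [stateSum_under, stateSum_turnback_pairing hm hi, stateSum_under, stateSum_under,
    stateSum_turnback_cap hm hi hj hij, stateSum_turnback_cap hm' hi hj hij,
    stateSum_cap_cup_single hi, stateSum_zigzag hj hi hij.symm, stateSum_cap_pairing hm hi]
  linear_combination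
    (stateSum (.plain (.cap j) :: w) m +
      d ^ (Piece.cap i).loops (m[·]?) * d * stateSum w single) * T_one_mul_T_neg_one +
      d ^ (Piece.cap i).loops (m[·]?) * stateSum w single * d_eq

theorem stateSum_cup_over_over (hi : i < 3) (hj : j < 3) (hij : i = j + 1 ∨ j = i + 1)
    (w : List Slice) :
    stateSum (.plain (.cup i) :: .over j :: .over i :: w) single =
      stateSum (.plain (.cup j) :: w) single := by
  rw [stateSum_cup, stateSum_cup, stateSum_over, stateSum_turnback_zigzag hj hi hij.symm,
    stateSum_over, stateSum_over, stateSum_turnback_act_cup hi, stateSum_turnback_zigzag hi hj hij]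
  linear_combination
    (stateSum w ((Piece.cup j).act single) + d * stateSum w ((Piece.cup i).act single)) *
      T_one_mul_T_neg_one + stateSum w ((Piece.cup i).act single) * d_eq

theorem stateSum_replicate (hi : i < 3) {a : Slice} {c : LaurentPolynomial ℤ}
    (ha : ∀ {w m}, stateSum (turnback i ++ w) m = d * stateSum w m →
      stateSum (a :: w) m = c * stateSum w m)
    (hm : m ∈ pairings) (h : stateSum (turnback i ++ w) m = d * stateSum w m) (n : ℕ) :
    stateSum (List.replicate n a ++ w) m = c ^ n * stateSum w m := by
  induction n generalizing w with
  | zero => simp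
  | succ n ih =>
    have h' : stateSum (turnback i ++ a :: w) m = d * stateSum (a :: w) m := by
      rw [stateSum_turnback_cons hm hi ha, h, ha h, mul_left_comm]
    rw [List.replicate_succ', List.append_assoc, List.singleton_append, ih h', ha h, pow_succ,
      mul_assoc]

theorem stateSum_twist (hm : m ∈ pairings) (h : stateSum (turnback 0 ++ w) m = d * stateSum w m)
    (t : ℤ) : stateSum (twist t ++ w) m = ↑(kink ^ t) * stateSum w m := by
  cases t with
  | ofNat n =>
    rw [twist, if_pos (show 0 ≤ Int.ofNat n from Int.natCast_nonneg n)]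
    exact (stateSum_replicate (by norm_num) stateSum_over_eq_kink_mul hm h n).trans (by simp)
  | negSucc n =>
    rw [twist, if_neg (by simp)]
    exact (stateSum_replicate (by norm_num) stateSum_under_eq_kink_inv_mul hm h (n + 1)).trans
      (by simp)

end Moves

theorem stateSum_lower_half {m : List ℕ} (hm : m ∈ pairings) (w : List Slice) :
    stateSum (.under 1 :: .over 0 :: .under 2 :: .under 2 :: .plain (.cap 1) :: w) m =
      stateSum (.plain (.cap 2) :: w) m := by
  rw [stateSum_under_congr (by norm_num) (fun m hm => stateSum_over_zero_under_two hm _) hm,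
    stateSum_under_under_cap hm (by norm_num) (by norm_num) (by norm_num)]

theorem stateSum_upper_half (w : List Slice) :
    stateSum (.plain (.cup 1) :: .over 2 :: .over 2 :: .under 0 :: .over 1 :: w) single =
      stateSum (.plain (.cup 2) :: w) single := by
  rw [stateSum_cup, stateSum_over_congr (by norm_num)
    (fun m hm => stateSum_over_two_under_zero hm _) (act_cup_single_mem_pairings 1 (by norm_num)),
    ← stateSum_cup, stateSum_cup_over_over (by norm_num) (by norm_num) (by norm_num)]

theorem stateSum_twist_lower_half (t : ℤ) (w : List Slice) :
    stateSum ([.plain (.cup 0), .plain (.cup 2), .plain (.virt 1)] ++ (twist t ++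
      .under 1 :: .over 0 :: .under 2 :: .under 2 :: .plain (.cap 1) :: w)) [] =
      ↑(kink ^ t) * stateSum w single := by
  have half_crossed := stateSum_lower_half crossed_mem_pairings w
  rw [stateSum_cap_crossed (by norm_num)] at half_crossed
  have half_parallel := stateSum_lower_half (act_cup_single_mem_pairings 0 (by norm_num)) w
  rw [act_cup_zero_single, stateSum_cap_cup_single (by norm_num)] at half_parallel
  rw [List.cons_append, stateSum_cup, act_cup_zero_nil, List.cons_append, stateSum_cup,
    List.cons_append, stateSum_virt_act_cup_single, List.nil_append,
    stateSum_twist crossed_mem_pairings, half_crossed]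
  rw [turnback, List.cons_append, stateSum_cap_crossed (by norm_num), List.cons_append,
    stateSum_cup, List.nil_append, act_cup_zero_single, half_parallel, half_crossed]

theorem stateSum_upper_half_twist (t : ℤ) :
    stateSum (.plain (.cup 1) :: .over 2 :: .over 2 :: .under 0 :: .over 1 :: (twist t ++
      [.plain (.virt 1), .plain (.cap 2), .plain (.cap 0)])) single = ↑(kink ^ t) * d := by
  rw [stateSum_upper_half, stateSum_cup,
    stateSum_twist (act_cup_single_mem_pairings 2 (by norm_num))
      (by rw [← act_cup_zero_single, stateSum_turnback_act_cup (by norm_num)]),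
    stateSum_virt_act_cup_single, stateSum_cap_crossed (by norm_num), stateSum_cap_zero_single]

theorem stateSum_kdWord (t : ℤ) : stateSum (kdWord t) [] = d := by
  have halves : kdWord t =
      [.plain (.cup 0), .plain (.cup 2), .plain (.virt 1)] ++ (twist t ++
        .under 1 :: .over 0 :: .under 2 :: .under 2 :: .plain (.cap 1) ::
        .plain (.cup 1) :: .over 2 :: .over 2 :: .under 0 :: .over 1 :: (twist (-t) ++
          [.plain (.virt 1), .plain (.cap 2), .plain (.cap 0)])) := by
    simp [kdWord]
  rw [halves, stateSum_twist_lower_half, stateSum_upper_half_twist, ← mul_assoc, zpow_neg,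
    Units.mul_inv, one_mul]

theorem bracket_unknot : unknot.bracket = 1 := by
  apply bracket_eq_one
  rw [unknot, stateSum_cup, act_cup_zero_nil, stateSum_cap_zero_single]

theorem bracket_KD (t : ℤ) : (KD t).bracket = 1 :=
  bracket_eq_one (stateSum_kdWord t)

end VirtualKnot

theorem mainTheorem4 (t : ℤ) :
    (VirtualKnot.KD t).bracket = 1 ∧
      (VirtualKnot.KD t).bracket = VirtualKnot.unknot.bracket := by
  rw [VirtualKnot.bracket_KD, VirtualKnot.bracket_unknot]
  exact ⟨rfl, rfl⟩
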